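/- Let $N, W, L, M$ be positive integers. For a signal $\mathbf{x}=(x[0],\dots,x[N-1])^T\in\mathbb{C}^N$ and a window $\mathbf{w}=(w[0],\dots,w[W-1])^T\in\mathbb{C}^W$ (with $w[k]=0$ for $k\notin\{0,\dots,W-1\}$), define the short-time Fourier transform $$Y_w[m,r]=\sum_{n=0}^{N-1}x[n]\,w[rL-n]\,e^{-2\pi i mn/N},\qquad 0\le r\le R-1,\quad R=\Big\lceil\tfrac{N+W-1}{L}\Big\rceil .$$ Let $\mathbf{f}_m\in\mathbb{C}^N$ have entries $f_m[n]=e^{2\pi i mn/N}$, and let $\mathbf{W}_r$ be the $N\times N$ diagonal matrix with entries $w[rL-n]$, $0\le n\le N-1$. A vector is non-vanishing if all its entries are nonzero. Suppose that (i) $\mathbf{w}$ is non-vanishing, (ii) $2L\le W\le \frac N2$, and (iii) $4L\le M\le N$. Then for almost all (with respect to Lebesgue measure on $\mathbb{C}^N$) non-vanishing signals $\mathbf{x}_0\in\mathbb{C}^N$ the following holds. Let $Z_w[m,r]=|Y_w[m,r]|^2$ be the squared STFT magnitude of $\mathbf{x}_0$, and suppose that the samples $x_0[n]$, $0\le n\le\lfloor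 L/2\rfloor$, are known a priori. Then the STliFT semidefinite program $$\text{minimize } \operatorname{trace}(\mathbf{X})\quad\text{subject to}\quad \mathbf{X}\in\mathbb{C}^{N\times N},\ \mathbf{X}\succcurlyeq 0,\quad Z_w[m,r]=\operatorname{trace}(\mathbf{W}_r^\star\mathbf{f}_m\mathbf{f}_m^\star\mathbf{W}_r\mathbf{X})\ \ (1\le m\le M,\ 0\le r\le R-1),$$ with the prior information imposed as $X[n,m]=x_0[n]\overline{x_0[m]}$ for $0\le n,m\le\lfloor L/2\rfloor$, has $\mathbf{x}_0\mathbf{x}_0^\star$ as its unique feasible matrix. Consequently the vectors $\hat{\mathbf{x}}$ for which $\hat{\mathbf{x}}\hat{\mathbf{x}}^\star$ is a best approximation in Frobenius norm, among the matrices $\mathbf{z}\mathbf{z}^\star$ with $\mathbf{z}\in\mathbb{C}^N$, of a minimizer of this program are exactly the vectors $c\,\mathbf{x}_0$ with $c\in\mathbb{C}$, $|c|=1$; that is, the signal is recovered up to a global phase. -/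

import Mathlib

open MeasureTheory Matrix
open scoped ComplexOrder

namespace STFT

noncomputable section

/-- A vector (signal or window) is non-vanishing if none of its entries is zero. -/
def NonVanishing {n : ℕ} (x : Fin n → ℂ) : Prop := ∀ i, x i ≠ 0

/-- The window as a function on all integers: `w[k]` for `0 ≤ k ≤ W - 1`, and `0` elsewhere. -/
def extend {W : ℕ} (w : Fin W → ℂ) (k : ℤ) : ℂ :=
  if h : 0 ≤ k ∧ k < W then w ⟨k.toNat, by omega⟩ else 0

/-- The flipped window shifted by `r * L` units, `w_r[n] = w[rL - n]` for `0 ≤ n ≤ N - 1`. -/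
def shiftedWindow {W : ℕ} (N : ℕ) (w : Fin W → ℂ) (L r : ℕ) (n : Fin N) : ℂ :=
  extend w ((r : ℤ) * L - (n : ℕ))

/-- The number of short-time sections, `R = ⌈(N + W - 1) / L⌉`. -/
def numSections (N W L : ℕ) : ℕ := ⌈((N : ℝ) + W - 1) / L⌉₊

/-- The short-time Fourier transform
`Y_w[m, r] = ∑ n, x[n] w[rL - n] exp (-2πi m n / N)`. -/
def stft {N W : ℕ} (w : Fin W → ℂ) (L : ℕ) (x : Fin N → ℂ) (m r : ℕ) : ℂ :=
  ∑ n : Fin N, x n * shiftedWindow N w L r n *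
    Complex.exp (-(Complex.I * (2 * Real.pi * ((m : ℂ) * (n : ℕ)) / N)))

/-- The STFT magnitude-square measurements `Z_w[m, r] = |Y_w[m, r]|²`. -/
def stftMagSq {N W : ℕ} (w : Fin W → ℂ) (L : ℕ) (x : Fin N → ℂ) (m r : ℕ) : ℝ :=
  ‖stft w L x m r‖ ^ 2

/-- `f_m`, the conjugate of the `m`-th column of the `N`-point DFT matrix. -/
def dftVec (N m : ℕ) (n : Fin N) : ℂ :=
  star (Complex.exp (-(Complex.I * (2 * Real.pi * ((m : ℂ) * (n : ℕ)) / N))))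

/-- The diagonal matrix `W_r` with diagonal `w_r`. -/
def windowMatrix {W : ℕ} (N : ℕ) (w : Fin W → ℂ) (L r : ℕ) : Matrix (Fin N) (Fin N) ℂ :=
  Matrix.diagonal (shiftedWindow N w L r)

/-- The rank-one lift `x x^*`. -/
def lift {N : ℕ} (x : Fin N → ℂ) : Matrix (Fin N) (Fin N) ℂ := vecMulVec x (star x)

/-- The feasible set of the semidefinite program, with window `w`, shift `L`, measurements
`Z[m, r]` for `1 ≤ m ≤ M` and `0 ≤ r ≤ R - 1`, and the samples `s[n]`, `0 ≤ n ≤ k`, of the signal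
known a priori (other entries of `s` are not used). -/
def feasibleSet {N W : ℕ} (w : Fin W → ℂ) (L M : ℕ) (Z : ℕ → ℕ → ℝ) (k : ℕ) (s : Fin N → ℂ) :
    Set (Matrix (Fin N) (Fin N) ℂ) :=
  {X | X.PosSemidef ∧
    (∀ m r : ℕ, 1 ≤ m → m ≤ M → r < numSections N W L →
      (Z m r : ℂ) = Matrix.trace ((windowMatrix N w L r)ᴴ *
        vecMulVec (dftVec N m) (star (dftVec N m)) * windowMatrix N w L r * X)) ∧
    (∀ i j : Fin N, (i : ℕ) ≤ k → (j : ℕ) ≤ k → X i j = s i * star (s j))}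

/-- The squared Frobenius norm. -/
def frobSq {N : ℕ} (A : Matrix (Fin N) (Fin N) ℂ) : ℝ := ∑ i, ∑ j, ‖A i j‖ ^ 2

/-- `y` is an output of STliFT, run on a semidefinite program with feasible set `F`: `y y^*` is a
best approximation of the form `z z^*`, in Frobenius norm, of a minimizer of the trace over `F`. -/
def IsOutput {N : ℕ} (F : Set (Matrix (Fin N) (Fin N) ℂ)) (y : Fin N → ℂ) : Prop :=
  ∃ X ∈ F, (∀ X' ∈ F, X.trace.re ≤ X'.trace.re) ∧
    ∀ z : Fin N → ℂ, frobSq (X - lift y) ≤ frobSq (X - lift z)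

end

end STFT

namespace STFT

/-! Sections are treated in order, each extending the range on which a feasible `X` equals `x x^*`.
If `X` is known up to index `t`, positivity gives `X = y y^* + E` with `E ≥ 0`, where `y = x` up to
`t` and `E` vanishes on the known rows and columns (`exists_rankOne_extension`). Subtracting the
measurements of `x` in section `r` leaves equations linear in `β = w_r (y - x)`, its conjugate and
the windowed block `Γ` of `X - x x^*` on the new indices. `Γ` enters only through its
autocorrelation, at frequencies below `rL - t`; shifting the other terms by a known index `u` puts
`β` and its conjugate at the remaining frequencies, all of modulus at most `2L - 1`. Thus there are
`4L - 1` equations for `4L - 1` unknowns.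

If this system is regular, then `β = 0` and the trace of `Γ` vanishes. Now `Γ` has the diagonal of
the windowed `E`, which is nonnegative, so `E` vanishes on the new indices too
(`eq_lift_of_det_stepMatrix_ne_zero`).

The system is regular for almost every `x`: a signal concentrated at `u` turns its matrix into a
row-scaled Vandermonde matrix, and regularity at one signal gives it almost everywhere
(`ae_det_add_ne_zero`). -/

/-! ### Generic invertibility -/

/-- If `H a + D` is invertible for one `a`, where `H` is real-linear and the nonzero columns of `D`
are zero columns of every `H a`, then it is invertible for almost every `a`. -/
theorem ae_det_add_ne_zero {E ι : Type*} [NormedAddCommGroup E] [NormedSpace ℝ E]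
    [FiniteDimensional ℝ E] [MeasurableSpace E] [BorelSpace E] (μ : Measure E) [μ.IsAddHaarMeasure]
    [Fintype ι] [DecidableEq ι] (H : E →ₗ[ℝ] Matrix ι ι ℂ) (D : Matrix ι ι ℂ)
    (low : ι → Prop) (hH : ∀ a i j, low j → H a i j = 0) (hD : ∀ i j, ¬ low j → D i j = 0)
    (v : E) (hv : (H v + D).det ≠ 0) : ∀ᵐ a ∂μ, (H a + D).det ≠ 0 := by
  classical
  have hcont : Continuous fun a => (H a + D).det := by
    have : Continuous fun a => H a := H.continuous_of_finiteDimensional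
    fun_prop
  have hmeas : MeasurableSet {a | (H a + D).det ≠ 0} :=
    (isOpen_ne.preimage hcont).measurableSet
  -- By Fubini it suffices to find finitely many exceptions on each line `y + s v`.
  refine ae_mem_of_ae_add_linearMap_mem (LinearMap.toSpanSingleton ℝ E v) volume μ hmeas fun y => ?_
  set V := H v + D with hV
  have hVu : IsUnit V.det := isUnit_iff_ne_zero.2 hv
  have hfin : ({0} ∪ (fun s : ℝ => (s : ℂ)) ⁻¹' (↑(-(V⁻¹ * H y)).charpoly.roots.toFinset :
      Set ℂ)).Finite :=
    (Set.finite_singleton _).union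
      ((Finset.finite_toSet _).preimage Complex.ofReal_injective.injOn)
  refine measure_mono_null (fun s hs => ?_) (hfin.measure_zero volume)
  by_contra hcon
  simp only [Set.mem_union, Set.mem_singleton_iff, Set.mem_preimage, Finset.mem_coe,
    Multiset.mem_toFinset, not_or] at hcon
  obtain ⟨hs0, hroot⟩ := hcon
  rw [Polynomial.mem_roots (Matrix.charpoly_monic _).ne_zero, Polynomial.IsRoot.def,
    Matrix.eval_charpoly] at hroot
  -- Multiplying the constant columns by `s` turns the matrix on the line into `s V + H y`, singular
  -- only when `s` is an eigenvalue of `-V⁻¹ H y`.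
  have hscale : (H (y + s • v) + D) * Matrix.diagonal (fun j => if low j then (s : ℂ) else 1) =
      V * (Matrix.scalar ι (s : ℂ) - -(V⁻¹ * H y)) := by
    have h1 : V * (Matrix.scalar ι (s : ℂ) - -(V⁻¹ * H y)) = (s : ℂ) • V + H y := by
      rw [sub_neg_eq_add, mul_add, ← mul_assoc, Matrix.mul_nonsing_inv _ hVu, one_mul]
      congr 1
      ext i j
      simp [Matrix.scalar_apply, mul_comm]
    rw [h1]
    ext i j
    rw [Matrix.mul_diagonal]
    by_cases hl : low j
    · simp [hl, hV, hH, mul_comm]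
    · simp [hl, hV, hD]
      ring
  have hdet := congrArg Matrix.det hscale
  rw [Matrix.det_mul, Matrix.det_mul] at hdet
  have hz : (H (y + s • v) + D).det = 0 := by
    by_contra hne
    exact hs hne
  rw [hz, zero_mul] at hdet
  exact (mul_ne_zero hv hroot) hdet.symm

/-! ### Rank-one splitting of positive semidefinite matrices -/

variable {n : Type*} [Fintype n]

theorem _root_.Matrix.PosSemidef.apply_eq_zero_of_diag_eq_zero {A : Matrix n n ℂ}
    (hA : A.PosSemidef) {i : n} (hi : A i i = 0) (j : n) : A j i = 0 := by
  classical
  have h := (hA.dotProduct_mulVec_zero_iff (Pi.single i 1)).1 (by simp [hi])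
  simpa using congrFun h j

/-- A positive semidefinite matrix with a rank-one block splits off a rank-one matrix extending this
block, with positive semidefinite remainder. -/
theorem exists_rankOne_extension {X : Matrix n n ℂ} (hX : X.PosSemidef) (P : n → Prop) (x : n → ℂ)
    (hP : ∀ i j, P i → P j → X i j = x i * star (x j)) (p : n) (hp : P p) (hxp : x p ≠ 0) :
    ∃ y : n → ℂ, (∀ i, P i → y i = x i) ∧ (∀ i j, P i → X j i = y j * star (x i)) ∧
      (X - vecMulVec y (star y)).PosSemidef := by
  classical
  have hxp' : star (x p) ≠ 0 := star_ne_zero.2 hxp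
  let y : n → ℂ := fun j => X j p / star (x p)
  have hyp : y p = x p := by simp only [y]; rw [hP p p hp hp]; field_simp
  have hcol : ∀ i j, P i → X j i = y j * star (x i) := by
    intro i j hi
    -- This vector is isotropic for the rank-one block, hence lies in the kernel of `X`.
    have h := (hX.dotProduct_mulVec_zero_iff
      (star (x p) • Pi.single i 1 - star (x i) • Pi.single p 1)).1 (by
        simp only [mulVec_sub, mulVec_smul, mulVec_single_one, star_sub, star_smul, star_star,
          sub_dotProduct, smul_dotProduct, dotProduct_sub, dotProduct_smul, smul_eq_mul,
          Pi.star_single, star_one, single_one_dotProduct, col_apply]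
        rw [hP i i hi hi, hP i p hi hp, hP p i hp hi, hP p p hp hp]
        ring)
    have h2 := congrFun h j
    simp only [mulVec_sub, mulVec_smul, mulVec_single_one, Pi.sub_apply, Pi.smul_apply, col_apply,
      smul_eq_mul, Pi.zero_apply] at h2
    simp only [y]
    field_simp
    linear_combination h2
  refine ⟨y, fun i hi => ?_, hcol, ?_⟩
  · simp only [y]; rw [hP i p hi hp]; field_simp
  · have hkey : ∀ v : n → ℂ, star (X *ᵥ v) = star v ᵥ* X := by
      intro v
      rw [star_mulVec, hX.isHermitian.eq]
    refine PosSemidef.of_dotProduct_mulVec_nonneg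
      (hX.isHermitian.sub (posSemidef_vecMulVec_self_star y).isHermitian) fun v => ?_
    -- Schur complement: with this `c`, the form of `X` at `v - c e_p` is that of `X - y y^*` at
    -- `v`.
    set c := (star y ⬝ᵥ v) / star (x p) with hc
    have hnn := hX.dotProduct_mulVec_nonneg (v - c • Pi.single p 1)
    have hXe : X *ᵥ Pi.single p 1 = star (x p) • y := by
      ext j; simp [hcol p j hp, mul_comm]
    have heX : star (Pi.single p (1 : ℂ)) ᵥ* X = x p • star y := by
      rw [← hkey, hXe, star_smul, star_star]
    have hvy : star v ⬝ᵥ y = star (star y ⬝ᵥ v) := by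
      rw [← star_dotProduct_star, star_star]
    convert hnn using 1
    rw [sub_mulVec, dotProduct_sub, vecMulVec_mulVec, mulVec_sub, mulVec_smul, hXe, star_sub,
      star_smul]
    simp only [sub_dotProduct, dotProduct_sub, smul_dotProduct, dotProduct_smul, dotProduct_mulVec,
      sub_vecMul, smul_vecMul, heX, smul_eq_mul, op_smul_eq_smul, hvy]
    have : star (Pi.single p (1 : ℂ)) ⬝ᵥ y = x p := by
      rw [Pi.star_single, star_one, single_one_dotProduct, hyp]
    rw [this, hc, star_div₀, star_star]
    field_simp
    ring

/-! ### The linear system of one section -/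

/-- The `m`-th power of the conjugate primitive root of unity `exp (-2πi / N)`. -/
noncomputable def root (N m : ℕ) : ℂ := Complex.exp (-(Complex.I * (2 * Real.pi * m / N)))

theorem root_pow (N m n : ℕ) :
    root N m ^ n = Complex.exp (-(Complex.I * (2 * Real.pi * ((m : ℂ) * n) / N))) := by
  rw [root, ← Complex.exp_nat_mul]
  congr 1
  ring

theorem root_ne_zero (N m : ℕ) : root N m ≠ 0 := Complex.exp_ne_zero _

theorem star_root (N m : ℕ) : star (root N m) = (root N m)⁻¹ := by
  rw [root, ← Complex.exp_neg, Complex.star_def, ← Complex.exp_conj]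
  congr 1
  simp [Complex.conj_ofNat]

theorem root_injOn {N m m' : ℕ} (hm : m < N) (hm' : m' < N) (h : root N m = root N m') :
    m = m' := by
  have hN : N ≠ 0 := by omega
  have key : ∀ k, root N k = (Complex.exp (2 * Real.pi * Complex.I / N))⁻¹ ^ k := by
    intro k
    rw [root, ← Complex.exp_neg, ← Complex.exp_nat_mul]
    congr 1
    ring
  rw [key, key] at h
  exact (Complex.isPrimitiveRoot_exp N hN).inv.pow_inj hm hm' h

variable {N W : ℕ}

/-- The part of the short-time Fourier transform coming from the samples `x[n]`, `n ≤ t`. -/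
noncomputable def partialStft (w : Fin W → ℂ) (L r t : ℕ) (m : ℕ) (x : Fin N → ℂ) : ℂ :=
  ∑ n ∈ Finset.univ.filter (fun n : Fin N => (n : ℕ) ≤ t),
    x n * shiftedWindow N w L r n * root N m ^ (n : ℕ)

/-- The coefficient, in the measurement `m` of the section `r`, of the unknown of frequency `k`,
if the samples up to `t` are known. Frequencies of modulus less than `r * L - t` belong to the
autocorrelation of the new samples, the others to their products with the known samples. -/
noncomputable def stepCoeff (w : Fin W → ℂ) (L r t u m : ℕ) (x : Fin N → ℂ) (k : ℤ) : ℂ :=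
  if |k| + t < (r * L : ℕ) then root N m ^ k
  else if 0 < k then star (partialStft w L r t m x) * root N m ^ (u + k)
  else partialStft w L r t m x * root N m ^ (k - u)

/-- The frequency, between `-(2L - 1)` and `2L - 1`, of an index. -/
def freq (L : ℕ) (j : Fin (4 * L - 1)) : ℤ := (j : ℕ) - (2 * L - 1)

/-- The matrix of the linear system for the unknowns of a section. -/
noncomputable def stepMatrix (w : Fin W → ℂ) (L r t u : ℕ) (x : Fin N → ℂ) :
    Matrix (Fin (4 * L - 1)) (Fin (4 * L - 1)) ℂ :=
  .of fun i j => stepCoeff w L r t u (i + 1) x (freq L j)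

theorem partialStft_add (w : Fin W → ℂ) (L r t m : ℕ) (x y : Fin N → ℂ) :
    partialStft w L r t m (x + y) = partialStft w L r t m x + partialStft w L r t m y := by
  simp [partialStft, add_mul, Finset.sum_add_distrib]

theorem partialStft_smul (w : Fin W → ℂ) (L r t m : ℕ) (s : ℝ) (x : Fin N → ℂ) :
    partialStft w L r t m (s • x) = s * partialStft w L r t m x := by
  simp [partialStft, Finset.mul_sum, mul_assoc]

/-- The part of `stepMatrix` which depends on the signal. -/
noncomputable def crossMatrix (w : Fin W → ℂ) (L r t u : ℕ) :
    (Fin N → ℂ) →ₗ[ℝ] Matrix (Fin (4 * L - 1)) (Fin (4 * L - 1)) ℂ where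
  toFun x := .of fun i j =>
    if |freq L j| + t < (r * L : ℕ) then 0
    else if 0 < freq L j then
      star (partialStft w L r t (i + 1) x) * root N (i + 1) ^ (u + freq L j)
    else partialStft w L r t (i + 1) x * root N (i + 1) ^ (freq L j - u)
  map_add' x y := by
    ext i j
    simp only [partialStft_add, star_add, add_mul, of_apply, Matrix.add_apply]
    split_ifs <;> simp
  map_smul' s x := by
    ext i j
    simp only [partialStft_smul, of_apply, Matrix.smul_apply, RingHom.id_apply, Complex.real_smul]
    split_ifs <;> simp [mul_assoc]

theorem stepMatrix_eq (w : Fin W → ℂ) (L r t u : ℕ) (x : Fin N → ℂ) :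
    stepMatrix w L r t u x = crossMatrix w L r t u x + .of fun i j =>
      if |freq L j| + t < (r * L : ℕ) then root N (i + 1) ^ freq L j else 0 := by
  ext i j
  simp only [stepMatrix, stepCoeff, crossMatrix, LinearMap.coe_mk, AddHom.coe_mk, of_apply,
    Matrix.add_apply]
  split_ifs <;> simp

theorem shiftedWindow_ne_zero {w : Fin W → ℂ} (hw : NonVanishing w) {L r : ℕ} {n : Fin N}
    (h1 : (n : ℕ) ≤ r * L) (h2 : r * L < n + W) : shiftedWindow N w L r n ≠ 0 := by
  have h : (0 : ℤ) ≤ (r : ℤ) * L - (n : ℕ) ∧ (r : ℤ) * L - (n : ℕ) < W := by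
    rw [← Nat.cast_mul]
    generalize r * L = q at h1 h2 ⊢
    omega
  rw [shiftedWindow, extend, dif_pos h]
  exact hw _

theorem shiftedWindow_eq_zero (w : Fin W → ℂ) {L r : ℕ} {n : Fin N} (h : r * L < n) :
    shiftedWindow N w L r n = 0 := by
  rw [shiftedWindow, extend, dif_neg]
  rw [← Nat.cast_mul]
  generalize r * L = q at h ⊢
  omega

theorem partialStft_single (w : Fin W → ℂ) {L r t m : ℕ} {u : Fin N} (hut : (u : ℕ) ≤ t)
    (hu : shiftedWindow N w L r u ≠ 0) :
    partialStft w L r t m (Pi.single u (shiftedWindow N w L r u)⁻¹) = root N m ^ (u : ℕ) := by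
  rw [partialStft, Finset.sum_eq_single u]
  · simp [hu]
  · intro b _ hb
    simp [hb]
  · intro h
    simp [hut] at h

/-- Removing the lowest power from each row leaves a Vandermonde matrix, with distinct nodes because
the exponents `1, …, 4L - 1` are below `N`. -/
theorem det_root_zpow_ne_zero {L : ℕ} (hLN : 4 * L ≤ N) :
    (Matrix.of fun i j : Fin (4 * L - 1) => root N (i + 1) ^ freq L j).det ≠ 0 := by
  have h : (Matrix.of fun i j : Fin (4 * L - 1) => root N (i + 1) ^ freq L j) =
      .of fun i j => root N ((i : ℕ) + 1) ^ (-(2 * L - 1) : ℤ) *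
        vandermonde (fun i : Fin (4 * L - 1) => root N (i + 1)) i j := by
    ext i j
    rw [of_apply, of_apply, vandermonde_apply, freq, ← zpow_natCast, ← zpow_add₀ (root_ne_zero _ _)]
    congr 1
    ring
  rw [h, Matrix.det_mul_column]
  refine mul_ne_zero (Finset.prod_ne_zero_iff.2 fun i _ => zpow_ne_zero _ (root_ne_zero _ _)) ?_
  rw [det_vandermonde_ne_zero_iff]
  intro i j hij
  have := root_injOn (by omega) (by omega) hij
  ext
  omega

theorem ae_det_stepMatrix_ne_zero {w : Fin W → ℂ} (hw : NonVanishing w) {L r t : ℕ}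
    (hLN : 4 * L ≤ N) (u : Fin N) (hut : (u : ℕ) ≤ t) (hur : (u : ℕ) ≤ r * L)
    (huW : r * L < u + W) :
    ∀ᵐ x : Fin N → ℂ ∂volume, (stepMatrix w L r t u x).det ≠ 0 := by
  simp only [stepMatrix_eq]
  -- The test signal has partial transform `root ^ u`, which cancels the shift by `u` in every cross
  -- column.
  refine ae_det_add_ne_zero volume (crossMatrix w L r t u) _
    (fun j => |freq L j| + t < (r * L : ℕ)) (fun a i j hj => ?_) (fun i j hj => ?_)
    (Pi.single u (shiftedWindow N w L r u)⁻¹) ?_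
  · simp only [crossMatrix, LinearMap.coe_mk, AddHom.coe_mk, of_apply, if_pos hj]
  · simp only [of_apply, if_neg hj]
  · rw [← stepMatrix_eq]
    convert det_root_zpow_ne_zero hLN using 3
    ext i j
    simp only [of_apply, stepMatrix, stepCoeff,
      partialStft_single w hut (shiftedWindow_ne_zero hw hur huW)]
    have hz := root_ne_zero N (i + 1)
    split_ifs
    · rfl
    · rw [star_pow, star_root, zpow_add₀ hz, zpow_natCast, inv_pow, inv_mul_cancel_left₀]
      exact pow_ne_zero _ hz
    · rw [zpow_sub₀ hz, zpow_natCast, mul_div_cancel₀]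
      exact pow_ne_zero _ hz

/-! ### Separating the frequencies -/

theorem exists_freq_eq {L : ℕ} {k : ℤ} (hk : |k| + 1 ≤ 2 * L) : ∃ j, freq L j = k := by
  have := abs_le.1 (show |k| ≤ 2 * L - 1 by omega)
  exact ⟨⟨(k + (2 * L - 1)).toNat, by omega⟩, by simp only [freq]; omega⟩

theorem freq_injective (L : ℕ) : Function.Injective (freq L) := fun i j h => by
  simp only [freq] at h
  ext
  omega

theorem sum_freq_ite {L : ℕ} (g : ℤ → ℂ) (a : ℂ) {k : ℤ} (hk : |k| + 1 ≤ 2 * L) :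
    ∑ j, g (freq L j) * (if freq L j = k then a else 0) = g k * a := by
  obtain ⟨j, rfl⟩ := exists_freq_eq hk
  rw [Finset.sum_eq_single j]
  · simp
  · intro i _ hi
    simp [(freq_injective L).ne hi]
  · simp

/-- The indices of the new samples in section `r`, if the samples up to `t` are known. -/
def newBlock (N t q : ℕ) : Finset (Fin N) :=
  Finset.univ.filter fun n => t < (n : ℕ) ∧ (n : ℕ) ≤ q

theorem mem_newBlock {t q : ℕ} {n : Fin N} : n ∈ newBlock N t q ↔ t < (n : ℕ) ∧ (n : ℕ) ≤ q := by
  simp [newBlock]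

theorem stepCoeff_autocorrelation (w : Fin W → ℂ) {L r t : ℕ} (u m : ℕ) (x : Fin N → ℂ)
    {n n' : Fin N} (hn : n ∈ newBlock N t (r * L)) (hn' : n' ∈ newBlock N t (r * L)) :
    stepCoeff w L r t u m x ((n : ℕ) - (n' : ℕ)) =
      root N m ^ (n : ℕ) * star (root N m ^ (n' : ℕ)) := by
  rw [mem_newBlock] at hn hn'
  rw [stepCoeff, if_pos, star_pow, star_root, zpow_sub₀ (root_ne_zero _ _), zpow_natCast,
    zpow_natCast, inv_pow, div_eq_mul_inv]
  generalize r * L = q at *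
  have := abs_lt.2 (show -((q : ℤ) - t) < ((n : ℕ) : ℤ) - (n' : ℕ) ∧
    ((n : ℕ) : ℤ) - (n' : ℕ) < (q : ℤ) - t by omega)
  omega

/-- As `n ≥ t + 1`, `hq` gives `n - u ≥ rL - t`: cross frequencies lie beyond all autocorrelation
frequencies. -/
theorem stepCoeff_cross (w : Fin W → ℂ) {L r t u m : ℕ} (x : Fin N → ℂ) (hut : u ≤ t)
    (hq : r * L + u ≤ 2 * t + 1) {n : Fin N} (hn : n ∈ newBlock N t (r * L)) :
    stepCoeff w L r t u m x ((n : ℕ) - u) =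
      star (partialStft w L r t m x) * root N m ^ (n : ℕ) := by
  rw [mem_newBlock] at hn
  generalize hqq : r * L = q at *
  rw [stepCoeff, if_neg, if_pos, add_sub_cancel, zpow_natCast]
  · omega
  · rw [abs_of_pos (by omega), hqq]
    omega

theorem stepCoeff_cross_star (w : Fin W → ℂ) {L r t u m : ℕ} (x : Fin N → ℂ) (hut : u ≤ t)
    (hq : r * L + u ≤ 2 * t + 1) {n : Fin N} (hn : n ∈ newBlock N t (r * L)) :
    stepCoeff w L r t u m x (u - (n : ℕ)) =
      partialStft w L r t m x * star (root N m ^ (n : ℕ)) := by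
  rw [mem_newBlock] at hn
  generalize hqq : r * L = q at *
  rw [stepCoeff, if_neg, if_neg, sub_sub_cancel_left, _root_.zpow_neg, zpow_natCast, star_pow,
    star_root, inv_pow]
  · omega
  · rw [abs_of_neg (by omega), hqq]
    omega

/-- If the matrix of a section is invertible, then the equations of the section determine the new
samples and the energy of the remainder. -/
theorem eq_zero_of_det_stepMatrix_ne_zero {w : Fin W → ℂ} {L r t u : ℕ} {x : Fin N → ℂ}
    (hdet : (stepMatrix w L r t u x).det ≠ 0) (hL : 1 ≤ L) (hut : u ≤ t)
    (hu : r * L + 1 ≤ u + 2 * L) (hq : r * L + u ≤ 2 * t + 1)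
    (β : Fin N → ℂ) (Γ : Fin N → Fin N → ℂ)
    (h : ∀ m, 1 ≤ m → m < 4 * L →
      star (partialStft w L r t m x) * ∑ n ∈ newBlock N t (r * L), β n * root N m ^ (n : ℕ) +
      partialStft w L r t m x *
        ∑ n ∈ newBlock N t (r * L), star (β n) * star (root N m ^ (n : ℕ)) +
      ∑ n ∈ newBlock N t (r * L), ∑ n' ∈ newBlock N t (r * L),
        Γ n n' * (root N m ^ (n : ℕ) * star (root N m ^ (n' : ℕ))) = 0) :
    (∀ n ∈ newBlock N t (r * L), β n = 0) ∧ ∑ n ∈ newBlock N t (r * L), Γ n n = 0 := by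
  set B := newBlock N t (r * L) with hB
  let c : ℤ → ℂ := fun k => ∑ n ∈ B, (if k = (n : ℕ) - u then β n else 0) +
    ∑ n ∈ B, (if k = u - (n : ℕ) then star (β n) else 0) +
    ∑ n ∈ B, ∑ n' ∈ B, (if k = (n : ℕ) - (n' : ℕ) then Γ n n' else 0)
  have hmem : ∀ n ∈ B, t < (n : ℕ) ∧ (n : ℕ) ≤ r * L := fun n hn => mem_newBlock.1 hn
  have hr1 : ∀ n ∈ B, |((n : ℕ) : ℤ) - u| + 1 ≤ 2 * L := fun n hn => by
    have := hmem n hn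
    rw [abs_of_pos (by omega)]
    omega
  have hr2 : ∀ n ∈ B, |(u : ℤ) - (n : ℕ)| + 1 ≤ 2 * L := fun n hn => by
    rw [abs_sub_comm]
    exact hr1 n hn
  have hr3 : ∀ n ∈ B, ∀ n' ∈ B, |((n : ℕ) : ℤ) - (n' : ℕ)| + 1 ≤ 2 * L := fun n hn n' hn' => by
    have h1 := hmem n hn
    have h2 := hmem n' hn'
    have := abs_le.2 (show -(2 * L - 1 : ℤ) ≤ ((n : ℕ) : ℤ) - (n' : ℕ) ∧
      ((n : ℕ) : ℤ) - (n' : ℕ) ≤ 2 * L - 1 by omega)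
    omega
  have hker : stepMatrix w L r t u x *ᵥ (fun j => c (freq L j)) = 0 := by
    ext i
    have hi := h (i + 1) (by omega) (by omega)
    rw [Pi.zero_apply, ← hi]
    simp only [mulVec, dotProduct, stepMatrix, of_apply, c, mul_add, Finset.sum_add_distrib,
      Finset.mul_sum]
    congr 1
    · congr 1
      · rw [Finset.sum_comm]
        refine Finset.sum_congr rfl fun n hn => ?_
        rw [sum_freq_ite _ _ (hr1 n hn), stepCoeff_cross w x hut hq hn]
        ring
      · rw [Finset.sum_comm]
        refine Finset.sum_congr rfl fun n hn => ?_
        rw [sum_freq_ite _ _ (hr2 n hn), stepCoeff_cross_star w x hut hq hn]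
        ring
    · rw [Finset.sum_comm]
      refine Finset.sum_congr rfl fun n hn => ?_
      rw [Finset.sum_comm]
      refine Finset.sum_congr rfl fun n' hn' => ?_
      rw [sum_freq_ite _ _ (hr3 n hn n' hn'), stepCoeff_autocorrelation w u _ x hn hn']
      ring
  have hc0 : ∀ k : ℤ, |k| + 1 ≤ 2 * L → c k = 0 := by
    intro k hk
    obtain ⟨j, rfl⟩ := exists_freq_eq hk
    exact congrFun (Matrix.eq_zero_of_mulVec_eq_zero hdet hker) j
  constructor
  · intro n₀ hn₀
    have h0 := hmem n₀ hn₀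
    have hc := hc0 _ (hr1 n₀ hn₀)
    simp only [c] at hc
    -- Frequency `n₀ - u` carries only `β n₀`: the conjugate terms are negative and the differences
    -- `n - n'` are too small.
    rw [Finset.sum_eq_single_of_mem n₀ hn₀, if_pos rfl, Finset.sum_eq_zero, Finset.sum_eq_zero,
      add_zero, add_zero] at hc
    · exact hc
    · intro n hn
      refine Finset.sum_eq_zero fun n' hn' => if_neg ?_
      have h1 := hmem n hn
      have h2 := hmem n' hn'
      omega
    · intro n hn
      have h1 := hmem n hn
      exact if_neg (by omega)
    · intro n hn hne
      refine if_neg fun hk => hne ?_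
      ext
      omega
  -- Frequency zero carries exactly the trace of `Γ`.
  · have hc := hc0 0 (by simp; omega)
    simp only [c] at hc
    rw [Finset.sum_eq_zero, Finset.sum_eq_zero, add_zero, zero_add] at hc
    · rw [← hc]
      refine Finset.sum_congr rfl fun n hn => ?_
      rw [Finset.sum_eq_single_of_mem n hn, if_pos (sub_self _).symm]
      intro n' hn' hne
      refine if_neg fun hk => hne ?_
      ext
      omega
    · intro n hn
      have h1 := hmem n hn
      exact if_neg (by omega)
    · intro n hn
      have h1 := hmem n hn
      exact if_neg (by omega)

/-! ### Measurements as traces, and the output -/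

theorem star_dftVec (N m : ℕ) (n : Fin N) : star (dftVec N m n) = root N m ^ (n : ℕ) := by
  rw [dftVec, star_star, root_pow]

theorem trace_measurement (w : Fin W → ℂ) (L r m : ℕ) (X : Matrix (Fin N) (Fin N) ℂ) :
    Matrix.trace ((windowMatrix N w L r)ᴴ * vecMulVec (dftVec N m) (star (dftVec N m)) *
      windowMatrix N w L r * X) =
      ∑ i, ∑ j, (shiftedWindow N w L r i * root N m ^ (i : ℕ)) *
        star (shiftedWindow N w L r j * root N m ^ (j : ℕ)) * X i j := by
  rw [trace, Finset.sum_comm]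
  refine Finset.sum_congr rfl fun j _ => ?_
  rw [diag_apply, Matrix.mul_apply]
  refine Finset.sum_congr rfl fun i _ => ?_
  rw [windowMatrix, diagonal_conjTranspose, mul_diagonal, diagonal_mul, vecMulVec_apply,
    Pi.star_apply, Pi.star_apply, star_mul', ← star_dftVec, ← star_dftVec, star_star]
  ring

theorem stft_eq (w : Fin W → ℂ) (L m r : ℕ) (x : Fin N → ℂ) :
    stft w L x m r = ∑ n, x n * (shiftedWindow N w L r n * root N m ^ (n : ℕ)) := by
  simp only [stft, root_pow, mul_assoc]

theorem stftMagSq_eq_trace (w : Fin W → ℂ) (L m r : ℕ) (x : Fin N → ℂ) :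
    (stftMagSq w L x m r : ℂ) = Matrix.trace ((windowMatrix N w L r)ᴴ *
      vecMulVec (dftVec N m) (star (dftVec N m)) * windowMatrix N w L r * lift x) := by
  rw [trace_measurement, stftMagSq, Complex.ofReal_pow, ← Complex.mul_conj', stft_eq, map_sum,
    Finset.sum_mul_sum]
  refine Finset.sum_congr rfl fun i _ => Finset.sum_congr rfl fun j _ => ?_
  rw [lift, vecMulVec_apply, Pi.star_apply, map_mul]
  simp only [Complex.star_def]
  ring

theorem lift_mem_feasibleSet (w : Fin W → ℂ) (L M k : ℕ) (x : Fin N → ℂ) :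
    lift x ∈ feasibleSet w L M (stftMagSq w L x) k x :=
  ⟨posSemidef_vecMulVec_self_star x, fun m r _ _ _ => stftMagSq_eq_trace w L m r x,
    fun _ _ _ _ => rfl⟩

/-- The minimizer already has rank one, so the best approximation error is zero; comparing one
nonzero column gives the phase. -/
theorem isOutput_singleton_lift_iff {x y : Fin N → ℂ} (n : Fin N) (hn : x n ≠ 0) :
    IsOutput {lift x} y ↔ ∃ c : ℂ, ‖c‖ = 1 ∧ y = c • x := by
  have hnn : ∀ A : Matrix (Fin N) (Fin N) ℂ, 0 ≤ frobSq A := fun A => by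
    unfold frobSq
    positivity
  constructor
  · rintro ⟨X, rfl, -, hX⟩
    have h0 : frobSq (lift x - lift y) = 0 := by
      refine le_antisymm ((hX x).trans ?_) (hnn _)
      simp [frobSq]
    have heq : ∀ i j, x i * star (x j) = y i * star (y j) := by
      intro i j
      unfold frobSq at h0
      rw [Finset.sum_eq_zero_iff_of_nonneg (fun _ _ => by positivity)] at h0
      have h1 := h0 i (Finset.mem_univ _)
      rw [Finset.sum_eq_zero_iff_of_nonneg (fun _ _ => by positivity)] at h1
      have h2 := h1 j (Finset.mem_univ _)
      rw [pow_eq_zero_iff two_ne_zero, norm_eq_zero] at h2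
      exact sub_eq_zero.1 h2
    have hnorm : ‖x n‖ = ‖y n‖ := by
      have := congrArg norm (heq n n)
      rw [norm_mul, norm_mul, norm_star, norm_star] at this
      exact (mul_self_inj (norm_nonneg _) (norm_nonneg _)).1 this
    have hyn : y n ≠ 0 := by
      rw [← norm_ne_zero_iff, ← hnorm]
      exact norm_ne_zero_iff.2 hn
    refine ⟨star (x n) / star (y n), ?_, ?_⟩
    · rw [norm_div, norm_star, norm_star, hnorm, div_self (norm_ne_zero_iff.2 hyn)]
    · ext i
      rw [Pi.smul_apply, smul_eq_mul, div_mul_eq_mul_div, eq_div_iff (star_ne_zero.2 hyn),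
        ← heq i n, mul_comm]
  · rintro ⟨c, hc, rfl⟩
    have hl : lift (c • x) = lift x := by
      ext i j
      have : c * star c = 1 := by
        rw [Complex.star_def, Complex.mul_conj', hc]
        simp
      simp only [lift, vecMulVec_apply, Pi.star_apply, Pi.smul_apply, smul_eq_mul, star_mul']
      linear_combination (x i * star (x j)) * this
    refine ⟨lift x, rfl, ?_, fun z => ?_⟩
    · rintro X' rfl
      rfl
    · rw [hl, sub_self]
      refine le_trans (le_of_eq ?_) (hnn _)
      simp [frobSq]

/-! ### Propagation through the sections -/

theorem sum_eq_sum_known_add_sum_newBlock {t q : ℕ} {f : Fin N → ℂ}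
    (hf : ∀ i : Fin N, q < (i : ℕ) → f i = 0) :
    ∑ i, f i = ∑ i ∈ Finset.univ.filter (fun n : Fin N => (n : ℕ) ≤ t), f i +
      ∑ i ∈ newBlock N t q, f i := by
  rw [← Finset.sum_filter_add_sum_filter_not Finset.univ (fun n : Fin N => (n : ℕ) ≤ t)]
  congr 1
  symm
  refine Finset.sum_subset (fun i hi => ?_) fun i hi hi' => hf i ?_
  · rw [mem_newBlock] at hi
    simpa using hi.1
  · rw [mem_newBlock] at hi'
    simp at hi
    omega

/-- If a feasible matrix agrees with the lift of the signal up to the index `t` and the linear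
system of the section `r` is regular, then it agrees with the lift up to the index `r * L`. -/
theorem eq_lift_of_det_stepMatrix_ne_zero {w : Fin W → ℂ} (hw : NonVanishing w) {L r t u : ℕ}
    {x : Fin N → ℂ} (hx : NonVanishing x) (hdet : (stepMatrix w L r t u x).det ≠ 0) (hL : 1 ≤ L)
    (hLW : 2 * L ≤ W) (hut : u ≤ t) (hu : r * L + 1 ≤ u + 2 * L) (hq : r * L + u ≤ 2 * t + 1)
    {X : Matrix (Fin N) (Fin N) ℂ} (hX : X.PosSemidef)
    (hm : ∀ m, 1 ≤ m → m < 4 * L → (stftMagSq w L x m r : ℂ) =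
      Matrix.trace ((windowMatrix N w L r)ᴴ * vecMulVec (dftVec N m) (star (dftVec N m)) *
        windowMatrix N w L r * X))
    (ht : ∀ i j : Fin N, (i : ℕ) ≤ t → (j : ℕ) ≤ t → X i j = x i * star (x j)) (i j : Fin N)
    (hi : (i : ℕ) ≤ r * L) (hj : (j : ℕ) ≤ r * L) : X i j = x i * star (x j) := by
  obtain ⟨y, hyx, hXy, hE⟩ := exists_rankOne_extension hX (fun i => (i : ℕ) ≤ t) x ht
    ⟨0, i.pos⟩ (Nat.zero_le _) (hx _)
  have hXy' : ∀ i j : Fin N, (i : ℕ) ≤ t → X i j = x i * star (y j) := fun i j hi => by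
    rw [← hX.isHermitian.apply i j, hXy i j hi, star_mul', star_star, mul_comm]
  obtain ⟨hβ, hΓ⟩ := eq_zero_of_det_stepMatrix_ne_zero hdet hL hut hu hq
    (fun n => shiftedWindow N w L r n * (y n - x n))
    (fun n n' => shiftedWindow N w L r n * star (shiftedWindow N w L r n') *
      (X n n' - x n * star (x n'))) (by
    intro m hm1 hm2
    have h := hm m hm1 hm2
    rw [stftMagSq_eq_trace, trace_measurement, trace_measurement, ← sub_eq_zero,
      ← Finset.sum_sub_distrib] at h
    simp only [← Finset.sum_sub_distrib, ← mul_sub] at h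
    rw [← neg_eq_zero, ← Finset.sum_neg_distrib] at h
    simp only [← Finset.sum_neg_distrib, ← mul_neg, neg_sub] at h
    have hz : ∀ i : Fin N, r * L < (i : ℕ) →
        shiftedWindow N w L r i * root N m ^ (i : ℕ) = 0 := fun i hi => by
      rw [shiftedWindow_eq_zero w hi, zero_mul]
    rw [sum_eq_sum_known_add_sum_newBlock (t := t) (q := r * L) (fun i hi => by simp [hz i hi])]
      at h
    simp only [fun i => sum_eq_sum_known_add_sum_newBlock (t := t) (q := r * L)
      (f := fun j => shiftedWindow N w L r i * root N m ^ (i : ℕ) *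
        star (shiftedWindow N w L r j * root N m ^ (j : ℕ)) * (X i j - lift x i j))
      (fun j hj => by rw [hz j hj]; simp), Finset.sum_add_distrib] at h
    rw [← h, partialStft, star_sum, Finset.sum_mul_sum, Finset.sum_mul_sum]
    have hzero : ∑ i ∈ Finset.univ.filter (fun n : Fin N => (n : ℕ) ≤ t),
        ∑ j ∈ Finset.univ.filter (fun n : Fin N => (n : ℕ) ≤ t),
        shiftedWindow N w L r i * root N m ^ (i : ℕ) *
        star (shiftedWindow N w L r j * root N m ^ (j : ℕ)) * (X i j - lift x i j) = 0 := by
      refine Finset.sum_eq_zero fun i hi => Finset.sum_eq_zero fun j hj => ?_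
      rw [Finset.mem_filter] at hi hj
      rw [ht i j hi.2 hj.2, lift, vecMulVec_apply, Pi.star_apply, sub_self, mul_zero]
    rw [hzero, zero_add, ← add_assoc, add_comm (∑ i ∈ _, ∑ j ∈ newBlock N t (r * L), _)]
    congr 1
    · congr 1
      · refine Finset.sum_congr rfl fun i hi => Finset.sum_congr rfl fun j _ => ?_
        rw [Finset.mem_filter] at hi
        rw [hXy' i j hi.2, lift, vecMulVec_apply, Pi.star_apply]
        simp only [star_mul', star_sub]
        ring
      · rw [Finset.sum_comm]
        refine Finset.sum_congr rfl fun i _ => Finset.sum_congr rfl fun j hj => ?_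
        rw [Finset.mem_filter] at hj
        rw [hXy j i hj.2, lift, vecMulVec_apply, Pi.star_apply]
        simp only [star_mul']
        ring
    · refine Finset.sum_congr rfl fun i _ => Finset.sum_congr rfl fun j _ => ?_
      rw [lift, vecMulVec_apply, Pi.star_apply]
      simp only [star_mul']
      ring)
  have hw0 : ∀ n ∈ newBlock N t (r * L), shiftedWindow N w L r n ≠ 0 := fun n hn => by
    rw [mem_newBlock] at hn
    exact shiftedWindow_ne_zero hw hn.2 (by omega)
  have hy : ∀ n : Fin N, (n : ℕ) ≤ r * L → y n = x n := fun n hn => by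
    by_cases hnt : (n : ℕ) ≤ t
    · exact hyx n hnt
    · have hmem : n ∈ newBlock N t (r * L) := mem_newBlock.2 ⟨by omega, hn⟩
      exact sub_eq_zero.1 ((mul_eq_zero.1 (hβ n hmem)).resolve_left (hw0 n hmem))
  by_cases hjt : (j : ℕ) ≤ t
  · rw [hXy j i hjt, hy i hi]
  · have hmem : j ∈ newBlock N t (r * L) := mem_newBlock.2 ⟨by omega, hj⟩
    have hdiag : ∀ n ∈ newBlock N t (r * L), X n n - x n * star (x n) =
        (X - vecMulVec y (star y)) n n := fun n hn => by
      rw [Matrix.sub_apply, vecMulVec_apply, Pi.star_apply, hy n (mem_newBlock.1 hn).2]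
    -- The terms are squared window moduli times diagonal entries of the remainder, so each vanishes
    -- and takes its column with it.
    rw [Finset.sum_eq_zero_iff_of_nonneg] at hΓ
    · have h0 := hΓ j hmem
      rw [hdiag j hmem, mul_eq_zero, mul_eq_zero, star_eq_zero, or_self] at h0
      have h1 := hE.apply_eq_zero_of_diag_eq_zero (h0.resolve_left (hw0 j hmem)) i
      rw [Matrix.sub_apply, vecMulVec_apply, Pi.star_apply, sub_eq_zero] at h1
      rw [h1, hy i hi, hy j hj]
    · intro n hn
      rw [hdiag n hn]
      exact mul_nonneg (mul_star_self_nonneg _) hE.diag_nonneg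

/-- Guarantees that the next section is measured as long as samples remain unknown. -/
theorem lt_numSections {L : ℕ} (hL : 1 ≤ L) (hLW : 2 * L ≤ W) {r : ℕ} (hr : 1 ≤ r)
    (hrN : (r - 1) * L < N) : r < numSections N W L := by
  obtain ⟨k, rfl⟩ : ∃ k, r = k + 1 := ⟨r - 1, by omega⟩
  rw [Nat.add_sub_cancel] at hrN
  have hL' : (0 : ℝ) < L := by exact_mod_cast hL
  rw [numSections, Nat.lt_ceil, lt_div_iff₀ hL']
  have h1 : (k : ℝ) * L + 1 ≤ N := by exact_mod_cast hrN
  have h2 : 2 * (L : ℝ) ≤ W := by exact_mod_cast hLW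
  push_cast
  nlinarith

/-- The feasible set is a singleton, provided that the linear systems of all sections are
regular. -/
theorem feasibleSet_eq_singleton {w : Fin W → ℂ} (hw : NonVanishing w) {L M : ℕ} {x : Fin N → ℂ}
    (hx : NonVanishing x) (hL : 1 ≤ L) (hLW : 2 * L ≤ W) (hLM : 4 * L ≤ M)
    (h1 : (stepMatrix w L 1 (L / 2) 0 x).det ≠ 0)
    (h2 : ∀ k, (k + 1) * L < N →
      (stepMatrix w L (k + 2) ((k + 1) * L) (k * L + 1) x).det ≠ 0) :
    feasibleSet w L M (stftMagSq w L x) (L / 2) x = {lift x} := by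
  refine Set.eq_singleton_iff_unique_mem.2 ⟨lift_mem_feasibleSet w L M _ x, ?_⟩
  rintro X ⟨hX, hmeas, hknown⟩
  have hstep : ∀ k, ∀ i j : Fin N, (i : ℕ) ≤ (k + 1) * L → (j : ℕ) ≤ (k + 1) * L →
      X i j = x i * star (x j) := by
    intro k
    induction k with
    | zero =>
      intro i j
      have hr : 1 < numSections N W L :=
        lt_numSections hL hLW le_rfl (by simpa using i.pos)
      -- With `u = 0` the separation condition reads `L ≤ 2⌊L/2⌋ + 1`, which explains the amount of
      -- prior information.
      exact eq_lift_of_det_stepMatrix_ne_zero hw hx h1 hL hLW (Nat.zero_le _) (by omega) (by omega)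
        hX (fun m hm1 hm2 => hmeas m 1 hm1 (by omega) hr) hknown i j
    | succ k ih =>
      intro i j hi hj
      by_cases hkN : (k + 1) * L < N
      · have hr : k + 2 < numSections N W L := lt_numSections hL hLW (by omega) hkN
        have e1 : (k + 1) * L = k * L + L := by ring
        have e2 : (k + 2) * L = k * L + 2 * L := by ring
        exact eq_lift_of_det_stepMatrix_ne_zero hw hx (h2 k hkN) hL hLW (by omega) (by omega)
          (by omega) hX (fun m hm1 hm2 => hmeas m (k + 2) hm1 (by omega) hr) ih i j hi hj
      · exact ih i j (by omega) (by omega)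
  ext i j
  have hN : N ≤ (N + 1) * L := by nlinarith
  exact hstep N i j (by omega) (by omega)

end STFT

theorem theorem2 (N W L M : ℕ) (hL : 1 ≤ L) (hLW : 2 * L ≤ W) (hWN : 2 * W ≤ N)
    (hLM : 4 * L ≤ M) (hMN : M ≤ N) (w : Fin W → ℂ) (hw : STFT.NonVanishing w) :
    ∀ᵐ x₀ : Fin N → ℂ ∂volume, STFT.NonVanishing x₀ →
      STFT.feasibleSet w L M (STFT.stftMagSq w L x₀) (L / 2) x₀ = {STFT.lift x₀} ∧
      ∀ y : Fin N → ℂ,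
        STFT.IsOutput (STFT.feasibleSet w L M (STFT.stftMagSq w L x₀) (L / 2) x₀) y ↔
          ∃ c : ℂ, ‖c‖ = 1 ∧ y = c • x₀ := by
  have h1 : ∀ᵐ x : Fin N → ℂ ∂volume, (STFT.stepMatrix w L 1 (L / 2) 0 x).det ≠ 0 :=
    STFT.ae_det_stepMatrix_ne_zero hw (by omega) ⟨0, by omega⟩ (Nat.zero_le _) (Nat.zero_le _)
      (by simp only; omega)
  have h2 : ∀ᵐ x : Fin N → ℂ ∂volume, ∀ k, (k + 1) * L < N →
      (STFT.stepMatrix w L (k + 2) ((k + 1) * L) (k * L + 1) x).det ≠ 0 := by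
    rw [ae_all_iff]
    intro k
    by_cases hk : (k + 1) * L < N
    · have e1 : (k + 1) * L = k * L + L := by ring
      have e2 : (k + 2) * L = k * L + 2 * L := by ring
      -- The index `u = kL + 1` gives equality in both frequency constraints; it is inside the
      -- window since `W ≥ 2L`.
      have := STFT.ae_det_stepMatrix_ne_zero (N := N) (L := L) (r := k + 2)
        (t := (k + 1) * L) hw (by omega)
        ⟨k * L + 1, by omega⟩ (by simp only; omega) (by simp only; omega) (by simp only; omega)
      filter_upwards [this] with x hx _ using hx
    · exact Filter.Eventually.of_forall fun x h => absurd h hk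
  filter_upwards [h1, h2] with x hx1 hx2 hx
  have hF := STFT.feasibleSet_eq_singleton hw hx hL hLW hLM hx1 hx2
  refine ⟨hF, fun y => ?_⟩
  rw [hF]
  exact STFT.isOutput_singleton_lift_iff ⟨0, by omega⟩ (hx _)
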